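/- For a completely metrizable space $X$, let $\mathrm{cov}(X)$ be the least cardinality of a family of subspaces of $X$, each of them a Polish space (separable and completely metrizable) in the subspace topology, whose union is $X$; and let $\mathfrak{mp}(X)$ be the least cardinality of a partition of $X$ (into nonempty, pairwise disjoint subsets) each of whose members is Polish in the subspace topology. Suppose that $\mathrm{cov}(X) < \mathfrak{mp}(X)$ for some completely metrizable space $X$. Then $\mathfrak{c} = 2^{\aleph_0} \geq \aleph_{\omega+2}$. -/

import Mathlib

open scoped Cardinal Ordinal

universe u

/-- `C` is a covering of `X` with Polish spaces: a family of subsets of `X`, each of them Polish in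
the subspace topology, whose union is `X`. -/
def IsPolishCovering (X : Type u) [TopologicalSpace X] (C : Set (Set X)) : Prop :=
  (∀ s ∈ C, PolishSpace s) ∧ ⋃₀ C = Set.univ

/-- `P` is a partition of `X` into Polish spaces: a family of nonempty, pairwise disjoint subsets
of `X` with union `X`, each of them Polish in the subspace topology. -/
def IsPolishPartition (X : Type u) [TopologicalSpace X] (P : Set (Set X)) : Prop :=
  (∀ s ∈ P, PolishSpace s) ∧ Setoid.IsPartition P

/-- The least cardinality of a covering of `X` with Polish spaces. -/
noncomputable def polishCov (X : Type u) [TopologicalSpace X] : Cardinal.{u} :=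
  sInf {κ | ∃ C : Set (Set X), IsPolishCovering X C ∧ #C = κ}

/-- The least cardinality of a partition of `X` into Polish spaces. -/
noncomputable def polishPart (X : Type u) [TopologicalSpace X] : Cardinal.{u} :=
  sInf {κ | ∃ P : Set (Set X), IsPolishPartition X P ∧ #P = κ}

theorem IsPolishPartition.isPolishCovering {X : Type u} [TopologicalSpace X] {P : Set (Set X)}
    (h : IsPolishPartition X P) : IsPolishCovering X P :=
  ⟨h.1, h.2.sUnion_eq_univ⟩

/-- The partition into singletons, so that both infima range over nonempty sets. -/
theorem isPolishPartition_singletons (X : Type u) [TopologicalSpace X] :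
    IsPolishPartition X (Set.range fun x : X => ({x} : Set X)) := by
  refine ⟨?_, ?_, fun a => ⟨{a}, ⟨⟨a, rfl⟩, rfl⟩, ?_⟩⟩
  · rintro _ ⟨x, rfl⟩
    infer_instance
  · rintro ⟨x, hx⟩
    exact Set.singleton_ne_empty x hx
  · rintro _ ⟨⟨x, rfl⟩, hx⟩
    rw [Set.mem_singleton_iff.1 hx]

/-- The minimum defining `polishCov X` is attained. -/
theorem exists_isPolishCovering_card_eq (X : Type u) [TopologicalSpace X] :
    ∃ C : Set (Set X), IsPolishCovering X C ∧ #C = polishCov X :=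
  csInf_mem (s := {κ | ∃ C : Set (Set X), IsPolishCovering X C ∧ #C = κ})
    ⟨_, _, (isPolishPartition_singletons X).isPolishCovering, rfl⟩

/-- The minimum defining `polishPart X` is attained. -/
theorem exists_isPolishPartition_card_eq (X : Type u) [TopologicalSpace X] :
    ∃ P : Set (Set X), IsPolishPartition X P ∧ #P = polishPart X :=
  csInf_mem (s := {κ | ∃ P : Set (Set X), IsPolishPartition X P ∧ #P = κ})
    ⟨_, _, isPolishPartition_singletons X, rfl⟩

/-!
The idea is the contrapositive: if `𝔠 ≤ ℵ_ (ω + 1)`, then a covering of a completely metrizable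
space `X` by `κ` Polish subspaces can be replaced by a partition into at most `κ` Polish subspaces.
If `κ` is countable, then `X` itself is Polish. There remain three ranges of `κ`.

* If `κ ≥ 𝔠`, the partition into points will do, since `X` has at most `κ * 𝔠 = κ` points.
* If `κ = ℵ_ n` with `n < ω`, then `X` has density at most `ℵ_ n`, and a `Gδ` set of density at most
  `ℵ_ n` is always a disjoint union of at most `ℵ_ n` Polish subspaces
  (`HasPolishDecomposition.of_densityLE_aleph_nat`). This goes by induction on `n`: a set of density
  `ℵ_ (n + 1)` is covered by a chain of closed sets `C i` of density at most `ℵ_ n`, and the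
  differences `C i \ ⋃ j < i, C j` are `Gδ`, because the union of a chain of closed sets in a
  metrizable space is an `Fσ` set (`isGδ_compl_iUnion_of_monotone`).
* If `κ = ℵ_ ω`, the covering splits into families of size at most `ℵ_ n`, `n < ω`. Baire category
  then shows that every nonempty closed subspace has a nonempty open part of density at most some `ℵ_ n`
  (`exists_isOpen_densityLE_aleph_nat`). Removing such parts transfinitely, each cut out by a member
  of a base of size `ℵ_ ω`, splits `X` into at most `ℵ_ ω` locally closed sets of density below `ℵ_ ω`
  (`exists_disjoint_cover_of_forall_isClosed`), to which the previous case applies.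

Hence a space whose covering number is less than its partition number has covering number strictly
between `ℵ_ ω` and `𝔠`.
-/

open Set TopologicalSpace
open Cardinal hiding univ

/-! ### Polish subspaces -/

theorem IsGδ.isCompletelyMetrizableSpace {X : Type u} [TopologicalSpace X]
    [IsCompletelyMetrizableSpace X] {A : Set X} (hA : IsGδ A) : IsCompletelyMetrizableSpace A := by
  obtain ⟨U, hU, rfl⟩ := hA.eq_iInter_nat
  have hUc (n : ℕ) : IsCompletelyMetrizableSpace (U n) := by
    let := upgradeIsCompletelyMetrizable X
    exact inferInstanceAs (IsCompletelyMetrizableSpace (Opens.CompleteCopy ⟨U n, hU n⟩))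
  -- The diagonal embeds the intersection as a closed subspace of the product of the open sets.
  let f : (⋂ n, U n : Set X) → ∀ n, U n := fun x n => ⟨x, mem_iInter.1 x.2 n⟩
  have hf : Continuous f := by fun_prop
  have hemb : Topology.IsEmbedding f :=
    .of_comp hf (g := fun y => (y 0 : X)) (by fun_prop) Topology.IsEmbedding.subtypeVal
  have hrange : range f = {y | ∀ n, (y n : X) = y 0} := by
    ext y
    constructor
    · rintro ⟨x, rfl⟩ n
      rfl
    · intro hy
      exact ⟨⟨y 0, mem_iInter.2 fun n => hy n ▸ (y n).2⟩,
        funext fun n => Subtype.ext (hy n).symm⟩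
  have hclosed : IsClosed (range f) := by
    rw [hrange, ofPred_forall]
    exact isClosed_iInter fun n => isClosed_eq (by fun_prop) (by fun_prop)
  exact Topology.IsClosedEmbedding.IsCompletelyMetrizableSpace ⟨hemb, hclosed⟩

theorem IsGδ.polishSpace {X : Type u} [TopologicalSpace X] [IsCompletelyMetrizableSpace X]
    {A : Set X} (hA : IsGδ A) (hs : IsSeparable A) : PolishSpace A := by
  have := hA.isCompletelyMetrizableSpace
  have := hs.separableSpace
  infer_instance

theorem PolishSpace.mk_le_continuum (Y : Type u) [TopologicalSpace Y] [PolishSpace Y] :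
    #Y ≤ 𝔠 := by
  borelize Y
  obtain ⟨f, -, hf⟩ := MeasurableSpace.measurable_injection_nat_bool_of_countablySeparated Y
  simpa using lift_mk_le_lift_mk_of_injective hf

/-! ### Decompositions into few Polish pieces -/

/-- `A` is the union of at most `κ` pairwise disjoint Polish subspaces of `X`; the empty set is
allowed as a piece. -/
def HasPolishDecomposition {X : Type u} [TopologicalSpace X] (κ : Cardinal.{u}) (A : Set X) :
    Prop :=
  ∃ P : Set (Set X), #P ≤ κ ∧ (∀ s ∈ P, PolishSpace s) ∧ P.PairwiseDisjoint id ∧ ⋃₀ P = A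

/-- `A` lies in the closure of at most `κ` points of the ambient space. Unlike the density of the
subspace `A`, this is visibly inherited by subsets; the points need not lie in `A`. -/
def DensityLE {X : Type u} [TopologicalSpace X] (κ : Cardinal.{u}) (A : Set X) : Prop :=
  ∃ s : Set X, #s ≤ κ ∧ A ⊆ closure s

variable {X : Type u} [TopologicalSpace X] {κ μ : Cardinal.{u}} {A B : Set X}

theorem DensityLE.mono (h : DensityLE κ B) (hκ : κ ≤ μ) (hAB : A ⊆ B) : DensityLE μ A :=
  let ⟨s, hs, hB⟩ := h
  ⟨s, hs.trans hκ, hAB.trans hB⟩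

theorem DensityLE.isSeparable (h : DensityLE ℵ₀ A) : IsSeparable A :=
  let ⟨s, hs, hA⟩ := h
  ⟨s, le_aleph0_iff_set_countable.1 hs, hA⟩

theorem DensityLE.closure_iUnion {ι : Type u} {s : ι → Set X} (hκ : ℵ₀ ≤ κ) (hι : #ι ≤ κ)
    (hs : ∀ i, IsSeparable (s i)) : DensityLE κ (closure (⋃ i, s i)) := by
  choose d hd hsd using hs
  refine ⟨⋃ i, d i, ?_, closure_minimal ?_ isClosed_closure⟩
  · refine (mk_iUnion_le d).trans (mul_le_of_le hκ hι ?_)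
    exact ciSup_le' fun i => ((hd i).le_aleph0).trans hκ
  · exact iUnion_subset fun i => (hsd i).trans (closure_mono (subset_iUnion d i))

theorem HasPolishDecomposition.mono (h : HasPolishDecomposition κ A) (hκ : κ ≤ μ) :
    HasPolishDecomposition μ A :=
  let ⟨P, hP, h'⟩ := h
  ⟨P, hP.trans hκ, h'⟩

theorem HasPolishDecomposition.empty : HasPolishDecomposition κ (∅ : Set X) :=
  ⟨∅, by simp, by simp, by simp, by simp⟩

theorem HasPolishDecomposition.iUnion {ι : Type u} {E : ι → Set X} (hκ : ℵ₀ ≤ κ) (hι : #ι ≤ κ)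
    (hd : Pairwise (Function.onFun Disjoint E)) (hE : ∀ i, HasPolishDecomposition κ (E i)) :
    HasPolishDecomposition κ (⋃ i, E i) := by
  choose P hP hpol hdis hU using hE
  refine ⟨⋃ i, P i, ?_, ?_, ?_, ?_⟩
  · exact (mk_iUnion_le P).trans (mul_le_of_le hκ hι (ciSup_le' hP))
  · intro s hs
    obtain ⟨i, hi⟩ := mem_iUnion.1 hs
    exact hpol i s hi
  · intro s hs t ht hst
    obtain ⟨i, hi⟩ := mem_iUnion.1 hs
    obtain ⟨j, hj⟩ := mem_iUnion.1 ht
    rcases eq_or_ne i j with rfl | hij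
    · exact hdis i hi hj hst
    · exact (hd hij).mono (hU i ▸ subset_sUnion_of_mem hi) (hU j ▸ subset_sUnion_of_mem hj)
  · rw [sUnion_iUnion]
    exact iUnion_congr hU

theorem IsPolishPartition.polishPart_le {P : Set (Set X)} (hP : IsPolishPartition X P) :
    polishPart X ≤ #P :=
  csInf_le' (s := {κ | ∃ P : Set (Set X), IsPolishPartition X P ∧ #P = κ}) ⟨P, hP, rfl⟩

theorem HasPolishDecomposition.polishPart_le (h : HasPolishDecomposition κ (univ : Set X)) :
    polishPart X ≤ κ := by
  obtain ⟨P, hP, hpol, hdis, hU⟩ := h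
  have hpart : IsPolishPartition X (P \ {∅}) := by
    refine ⟨fun s hs => hpol s hs.1, ?_⟩
    refine ⟨fun h => h.2 rfl, fun x => ?_⟩
    obtain ⟨s, hs, hx⟩ := mem_sUnion.1 (hU ▸ mem_univ x : x ∈ ⋃₀ P)
    refine ⟨s, ⟨⟨hs, fun h => ?_⟩, hx⟩, ?_⟩
    · rw [mem_singleton_iff.1 h] at hx
      exact hx
    · rintro t ⟨⟨ht, -⟩, hxt⟩
      exact hdis.elim_set ht hs x hxt hx
  exact (hpart.polishPart_le).trans ((mk_le_mk_of_subset sdiff_subset).trans hP)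

/-! ### Spaces of density below `ℵ_ω` -/

/-- A sequence in the union of a chain of sets lies in the union of countably many of them, so
without a countable cofinal set of indices it lies in a single member, which contains its limit. -/
theorem isClosed_iUnion_or_exists_countable_cofinal [FrechetUrysohnSpace X] {I : Type u}
    [LinearOrder I] {C : I → Set X} (hC : ∀ i, IsClosed (C i)) (hmono : Monotone C) :
    IsClosed (⋃ i, C i) ∨ ∃ T : Set I, T.Countable ∧ ∀ i, ∃ t ∈ T, i ≤ t := by
  by_contra! ⟨hncl, hT⟩
  refine hncl (isClosed_of_closure_subset fun x hx => ?_)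
  obtain ⟨y, hy, hyx⟩ := mem_closure_iff_seq_limit.1 hx
  choose i hi using fun n => mem_iUnion.1 (hy n)
  obtain ⟨k, hk⟩ := hT (range i) (countable_range i)
  exact mem_iUnion.2 ⟨k, (hC k).mem_of_tendsto hyx
    (.of_forall fun n => hmono (hk _ (mem_range_self n)).le (hi n))⟩

theorem isGδ_compl_iUnion_of_monotone [MetrizableSpace X] {I : Type u} [LinearOrder I]
    {C : I → Set X} (hC : ∀ i, IsClosed (C i)) (hmono : Monotone C) : IsGδ (⋃ i, C i)ᶜ := by
  rcases isClosed_iUnion_or_exists_countable_cofinal hC hmono with h | ⟨T, hTc, hT⟩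
  · exact h.isOpen_compl.isGδ
  · have : ⋃ i, C i = ⋃ t ∈ T, C t := by
      refine subset_antisymm (iUnion_subset fun i => ?_)
        (iUnion₂_subset fun t _ => subset_iUnion C t)
      obtain ⟨t, ht, hit⟩ := hT i
      exact (hmono hit).trans (subset_biUnion_of_mem (u := C) ht)
    rw [this, compl_iUnion₂]
    exact .biInter hTc fun t _ => (hC t).isOpen_compl.isGδ

theorem exists_linearOrder_mk_Iic_le {S : Type u} (hκ : ℵ₀ ≤ κ) (hS : #S ≤ Order.succ κ) :
    ∃ (_ : LinearOrder S) (_ : WellFoundedLT S), ∀ i : S, #(Iic i) ≤ κ := by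
  obtain ⟨_, _, h⟩ := exists_ord_eq_type_lt S
  refine ⟨‹_›, ‹_›, fun i => ?_⟩
  have h1 : #(Iio i) ≤ κ := by
    refine Order.lt_succ_iff.1 (lt_of_lt_of_le ?_ hS)
    have := Ordinal.typein_lt_type (α := S) (· < ·) i
    rw [← h, lt_ord] at this
    exact this
  rw [← Iio_insert]
  exact (mk_insert_le).trans (add_le_of_le hκ h1 (one_le_aleph0.trans hκ))

/-- The induction runs over all `Gδ` subsets of a fixed space, so that the differences of a chain of
closed sets are again covered by the induction hypothesis. -/
theorem HasPolishDecomposition.of_densityLE_aleph_nat [IsCompletelyMetrizableSpace X] (n : ℕ)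
    (hA : IsGδ A) (hd : DensityLE (ℵ_ n) A) : HasPolishDecomposition (ℵ_ n) A := by
  induction n generalizing A with
  | zero =>
    refine ⟨{A}, ?_, ?_, pairwiseDisjoint_singleton _ _, sUnion_singleton A⟩
    · rw [mk_singleton]
      exact one_le_aleph0.trans (aleph0_le_aleph _)
    · rintro _ rfl
      refine hA.polishSpace (DensityLE.isSeparable ?_)
      simpa using hd
  | succ n ih =>
    have hsucc : ℵ_ ((n + 1 : ℕ) : Ordinal.{u}) = Order.succ (ℵ_ (n : Ordinal.{u})) := by
      rw [Nat.cast_succ, succ_aleph]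
    obtain ⟨S, hS, hAS⟩ := hd
    rw [hsucc] at hS ⊢
    rcases lt_or_ge (ℵ_ (n : Ordinal.{u})) #S with hlt | hle
    swap
    · exact (ih hA ⟨S, hle, hAS⟩).mono (Order.le_succ _)
    obtain ⟨_, _, hI⟩ := exists_linearOrder_mk_Iic_le (aleph0_le_aleph n) hS
    let C : S → Set X := fun i => closure (Subtype.val '' Iic i)
    have hC (i : S) : IsClosed (C i) := isClosed_closure
    have hmono : Monotone C := fun i j hij => closure_mono (image_mono (Iic_subset_Iic.2 hij))
    -- A countable cofinal set would exhaust `S` by countably many initial segments, each of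
    -- size at most `ℵ_ n`.
    have hclosed : IsClosed (⋃ i, C i) := by
      refine (isClosed_iUnion_or_exists_countable_cofinal hC hmono).resolve_right ?_
      rintro ⟨T, hTc, hT⟩
      refine hlt.not_ge ?_
      have hU : (univ : Set S) ⊆ ⋃ t : T, Iic (t : S) := fun i _ => by
        obtain ⟨t, ht, hit⟩ := hT i
        exact mem_iUnion.2 ⟨⟨t, ht⟩, hit⟩
      calc #S = #(univ : Set S) := mk_univ.symm
        _ ≤ _ := mk_le_mk_of_subset hU
        _ ≤ _ := mk_iUnion_le _
        _ ≤ _ := mul_le_of_le (aleph0_le_aleph n) (hTc.le_aleph0.trans (aleph0_le_aleph n))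
          (ciSup_le' fun t => hI t)
    have hAC : A ⊆ ⋃ i, C i :=
      hAS.trans (closure_minimal (fun x hx => mem_iUnion.2
        ⟨⟨x, hx⟩, subset_closure ⟨⟨x, hx⟩, self_mem_Iic, rfl⟩⟩) hclosed)
    let E : S → Set X := fun i => A ∩ C i ∩ (⋃ j : Iio i, C j)ᶜ
    have hEA : ⋃ i, E i = A := by
      refine subset_antisymm (iUnion_subset fun i x hx => hx.1.1) fun x hx => ?_
      -- The point `x` belongs to the piece indexed by the least `i` with `x ∈ C i`.
      obtain ⟨i, hi, hmin⟩ := wellFounded_lt.has_min {i | x ∈ C i} (mem_iUnion.1 (hAC hx))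
      refine mem_iUnion.2 ⟨i, ⟨hx, hi⟩, fun h => ?_⟩
      obtain ⟨j, hj⟩ := mem_iUnion.1 h
      exact hmin j hj j.2
    rw [← hEA]
    refine HasPolishDecomposition.iUnion ((aleph0_le_aleph n).trans (Order.le_succ _)) hS ?_
      fun i => (ih ?_ ?_).mono (Order.le_succ _)
    · have key : ∀ i j : S, i < j → Disjoint (E i) (E j) := fun i j hij =>
        disjoint_left.2 fun x hxi hxj => hxj.2 (mem_iUnion.2 ⟨⟨i, hij⟩, hxi.1.2⟩)
      intro i j hij
      exact hij.lt_or_gt.elim (key i j) fun h => (key j i h).symm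
    · exact (hA.inter (hC i).isGδ).inter (isGδ_compl_iUnion_of_monotone (fun j => hC j)
        fun j k hjk => hmono hjk)
    · exact ⟨_, mk_image_le.trans (hI i), fun x hx => hx.1.2⟩

/-! ### Spaces of density `ℵ_ω` -/

/-- A transfinite derivative: sets `B i` are removed one at a time, each chosen so that `p` holds
of what it removes from the closed set left over so far. Since every step removes a point, the
process ends within the universe, and an index `i` is used at most once. -/
theorem exists_disjoint_cover_of_forall_isClosed {ι : Type u} {B : ι → Set X}
    (hB : ∀ i, IsOpen (B i)) {p : Set X → Prop}
    (h : ∀ F : Set X, IsClosed F → F.Nonempty → ∃ i, (B i ∩ F).Nonempty ∧ p (B i ∩ F)) :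
    ∃ E : ι → Set X, Pairwise (Function.onFun Disjoint E) ∧ ⋃ i, E i = univ ∧
      ∀ i, E i = ∅ ∨ (∃ F, IsClosed F ∧ E i = B i ∩ F) ∧ p (E i) := by
  classical
  rcases isEmpty_or_nonempty X with hX | ⟨⟨x₀⟩⟩
  · exact ⟨fun _ => ∅, fun _ _ _ => disjoint_empty _, Subsingleton.elim _ _, fun _ => .inl rfl⟩
  have : Nonempty ι := ⟨(h univ isClosed_univ ⟨x₀, trivial⟩).choose⟩
  choose! g hg hp using h
  -- `W α` is the open set removed before stage `α`, and `D α` below is what stage `α` removes.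
  obtain ⟨W, hW⟩ : ∃ W : Ordinal.{u} → Set X, ∀ α, W α = ⋃ β : Iio α, B (g (W β)ᶜ) :=
    ⟨wellFounded_lt.fix fun α W => ⋃ β : Iio α, B (g (W β β.2)ᶜ),
      fun α => wellFounded_lt.fix_eq _ α⟩
  have hWc (α) : IsClosed (W α)ᶜ := by
    rw [hW, isClosed_compl_iff]
    exact isOpen_iUnion fun β => hB _
  have hsub {β α} (hβ : β < α) : B (g (W β)ᶜ) ⊆ W α := by
    rw [hW α]
    exact subset_iUnion (fun β : Iio α => B (g (W β)ᶜ)) ⟨β, hβ⟩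
  let D : Ordinal.{u} → Set X := fun α => B (g (W α)ᶜ) ∩ (W α)ᶜ
  have hD {β α} (hβ : β < α) : Disjoint (D β) (D α) :=
    disjoint_left.2 fun x hxβ hxα => hxα.2 (hsub hβ hxβ.1)
  have hinj {β α} (hβ : (D β).Nonempty) (hα : (D α).Nonempty)
      (heq : g (W β)ᶜ = g (W α)ᶜ) : β = α := by
    by_contra hne
    wlog hlt : β < α generalizing α β
    · exact this hα hβ heq.symm (Ne.symm hne) (lt_of_le_of_ne (not_lt.1 hlt) (Ne.symm hne))
    obtain ⟨x, hx⟩ := hα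
    exact hx.2 (hsub hlt (heq ▸ hx.1))
  obtain ⟨γ, hγ⟩ : ∃ γ, W γ = univ := by
    by_contra! hne
    refine not_injective_of_ordinal (fun α => g (W α)ᶜ) fun α β => hinj ?_ ?_ <;>
      exact hg _ (hWc _) (nonempty_compl.2 (hne _))
  have hcov (x : X) : ∃ α, x ∈ D α := by
    obtain ⟨α, hα, hmin⟩ := wellFounded_lt.has_min {α | x ∈ W α} ⟨γ, hγ.ge (mem_univ x)⟩
    rw [mem_ofPred_eq, hW] at hα
    obtain ⟨β, hβ⟩ := mem_iUnion.1 hα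
    exact ⟨β, hβ, fun h => hmin β h β.2⟩
  refine ⟨fun i => ⋃ α, ⋃ (_ : g (W α)ᶜ = i), D α, fun i j hij => ?_, ?_, fun i => ?_⟩
  · refine disjoint_left.2 fun x hxi hxj => hij ?_
    simp only [mem_iUnion] at hxi hxj
    obtain ⟨α, rfl, hα⟩ := hxi
    obtain ⟨β, rfl, hβ⟩ := hxj
    rcases lt_trichotomy α β with hlt | rfl | hlt
    · exact (disjoint_left.1 (hD hlt) hα hβ).elim
    · rfl
    · exact (disjoint_left.1 (hD hlt) hβ hα).elim
  · refine eq_univ_of_forall fun x => ?_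
    obtain ⟨α, hα⟩ := hcov x
    simp only [mem_iUnion]
    exact ⟨_, α, rfl, hα⟩
  · by_cases hi : ∃ α, g (W α)ᶜ = i ∧ (D α).Nonempty
    · obtain ⟨α, rfl, hα⟩ := hi
      have : ⋃ β, ⋃ (_ : g (W β)ᶜ = g (W α)ᶜ), D β = D α := by
        refine subset_antisymm (iUnion₂_subset fun β hβ x hx => ?_)
          (subset_iUnion₂_of_subset α rfl subset_rfl)
        exact hinj ⟨x, hx⟩ hα hβ ▸ hx
      beta_reduce
      rw [this]
      exact .inr ⟨⟨_, hWc α, rfl⟩, hp _ (hWc α) (hα.mono inter_subset_right)⟩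
    · push Not at hi
      refine .inl ?_
      simp only [iUnion_eq_empty]
      exact hi

/-- Split a set of size at most `ℵ_ ω` into countably many parts, the `n`-th of size at most `ℵ_ n`. -/
theorem exists_nat_fibers_mk_le_aleph {α : Type u} (h : #α ≤ ℵ_ Ordinal.omega0) :
    ∃ f : α → ℕ, ∀ n, #(f ⁻¹' {n}) ≤ ℵ_ n := by
  have hle : #α ≤ #(Σ n : ℕ, (ℵ_ (n : Ordinal.{u})).out) := by
    refine h.trans ?_
    rw [aleph_limit Ordinal.isSuccLimit_omega0]
    refine ciSup_le' ?_
    rintro ⟨o, ho⟩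
    obtain ⟨n, rfl⟩ := Ordinal.lt_omega0.1 ho
    rw [← mk_out (ℵ_ (n : Ordinal.{u}))]
    exact mk_le_of_injective
      (f := Sigma.mk (β := fun n : ℕ => (ℵ_ (n : Ordinal.{u})).out) n) sigma_mk_injective
  obtain ⟨e⟩ := hle
  refine ⟨fun a => (e a).1, fun n => ?_⟩
  calc #((fun a => (e a).1) ⁻¹' {n}) = #(e '' ((fun a => (e a).1) ⁻¹' {n})) :=
        (mk_image_eq e.injective).symm
    _ ≤ #(range (Sigma.mk (β := fun n : ℕ => (ℵ_ (n : Ordinal.{u})).out) n)) := by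
        refine mk_le_mk_of_subset ?_
        rintro _ ⟨a, ha, rfl⟩
        exact range_sigmaMk n ▸ ha
    _ ≤ #(ℵ_ (n : Ordinal.{u})).out := mk_range_le
    _ = ℵ_ n := mk_out _

/-- The Baire category theorem in a nonempty closed subspace `F`: a covering of `F` by `ℵ_ω`
separable sets splits into subfamilies `𝒞 n` of at most `ℵ_ n` sets, `n < ω`, and the closure of
one of the unions `⋃₀ 𝒞 n` must have nonempty interior in `F`. -/
theorem exists_isOpen_densityLE_aleph_nat [IsCompletelyMetrizableSpace X] {C : Set (Set X)}
    (hC : ∀ s ∈ C, IsSeparable s) (hU : ⋃₀ C = univ) (hcard : #C ≤ ℵ_ Ordinal.omega0)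
    {F : Set X} (hF : IsClosed F) (hne : F.Nonempty) :
    ∃ U : Set X, IsOpen U ∧ (U ∩ F).Nonempty ∧ ∃ n : ℕ, DensityLE (ℵ_ n) (U ∩ F) := by
  obtain ⟨f, hf⟩ := exists_nat_fibers_mk_le_aleph hcard
  let Q : ℕ → Set X := fun n => closure (⋃ s : f ⁻¹' {n}, (s : Set X))
  have := hF.isCompletelyMetrizableSpace
  let := upgradeIsCompletelyMetrizable F
  have := hne.to_subtype
  obtain ⟨n, x, hx⟩ := nonempty_interior_of_iUnion_of_closed (X := F)
    (f := fun n => Subtype.val ⁻¹' Q n) (fun n => isClosed_closure.preimage continuous_subtype_val)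
    (eq_univ_of_forall fun x => by
      obtain ⟨s, hs, hxs⟩ := mem_sUnion.1 (hU ▸ mem_univ (x : X) : (x : X) ∈ ⋃₀ C)
      exact mem_iUnion.2 ⟨f ⟨s, hs⟩, subset_closure (mem_iUnion.2 ⟨⟨⟨s, hs⟩, rfl⟩, hxs⟩)⟩)
  obtain ⟨V, hVQ, hV, hxV⟩ := mem_interior.1 hx
  obtain ⟨U, hUo, rfl⟩ := isOpen_induced_iff.1 hV
  refine ⟨U, hUo, ⟨x, hxV, x.2⟩, n, ?_⟩
  exact (DensityLE.closure_iUnion (aleph0_le_aleph n) (hf n) fun s => hC s s.1.2).mono le_rfl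
    fun y hy => hVQ (a := ⟨y, hy.2⟩) hy.1

theorem HasPolishDecomposition.of_isPolishCovering_aleph_omega0 [IsCompletelyMetrizableSpace X]
    {C : Set (Set X)} (hC : IsPolishCovering X C) (hcard : #C ≤ ℵ_ Ordinal.omega0) :
    HasPolishDecomposition (ℵ_ Ordinal.omega0) (univ : Set X) := by
  have hsep : ∀ s ∈ C, IsSeparable s := fun s hs => by
    have := hC.1 s hs
    exact .of_subtype s
  obtain ⟨d, hd, hdU⟩ := DensityLE.closure_iUnion (aleph0_le_aleph _) hcard
    fun s : C => hsep s s.2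
  rw [← sUnion_eq_iUnion, hC.2, closure_univ] at hdU
  let := upgradeIsCompletelyMetrizable X
  -- A base of at most `ℵ_ω` open sets.
  let B : d × ULift.{u} ℕ → Set X := fun i => Metric.ball i.1 (1 / (i.2.down + 1))
  have hB : #(d × ULift.{u} ℕ) ≤ ℵ_ Ordinal.omega0 := by
    rw [mk_prod, lift_id, lift_id]
    refine mul_le_of_le (aleph0_le_aleph _) hd ?_
    rw [mk_uLift, mk_nat, lift_aleph0]
    exact aleph0_le_aleph _
  obtain ⟨E, hdis, hE, hEi⟩ := exists_disjoint_cover_of_forall_isClosed (B := B)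
    (fun i => Metric.isOpen_ball) (p := fun A => ∃ n : ℕ, DensityLE (ℵ_ n) A) (by
      intro F hF hne
      obtain ⟨U, hU, ⟨x, hxU, hxF⟩, n, hn⟩ :=
        exists_isOpen_densityLE_aleph_nat hsep hC.2 hcard hF hne
      obtain ⟨ε, hε, hεU⟩ := Metric.isOpen_iff.1 hU x hxU
      obtain ⟨k, hk⟩ := exists_nat_one_div_lt (half_pos hε)
      obtain ⟨y, hyd, hy⟩ := Metric.mem_closure_iff.1 (hdU (mem_univ x)) (1 / (k + 1))
        Nat.one_div_pos_of_nat
      refine ⟨(⟨y, hyd⟩, ⟨k⟩), ⟨x, hy, hxF⟩, n, hn.mono le_rfl (inter_subset_inter_left F ?_)⟩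
      refine fun z hz => hεU ?_
      rw [Metric.mem_ball] at hz ⊢
      dsimp only at hz
      rw [dist_comm] at hy
      linarith [dist_triangle z y x])
  rw [← hE]
  refine HasPolishDecomposition.iUnion (aleph0_le_aleph _) hB hdis fun i => ?_
  obtain h | ⟨⟨F, hF, hEF⟩, n, hn⟩ := hEi i
  · exact h ▸ .empty
  · refine (HasPolishDecomposition.of_densityLE_aleph_nat n ?_ hn).mono
      (aleph_le_aleph.2 (Ordinal.natCast_lt_omega0 n).le)
    exact hEF ▸ Metric.isOpen_ball.isGδ.inter hF.isGδ

/-! ### Comparing coverings and partitions -/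

theorem IsPolishCovering.mk_le {C : Set (Set X)} (hC : IsPolishCovering X C) : #X ≤ #C * 𝔠 := by
  rw [← mk_univ, ← hC.2]
  refine (mk_sUnion_le C).trans (mul_le_mul' le_rfl (ciSup_le' fun s => ?_))
  have := hC.1 s s.2
  exact PolishSpace.mk_le_continuum s

theorem polishPart_le_mk : polishPart X ≤ #X :=
  (isPolishPartition_singletons X).polishPart_le.trans mk_range_le

/-- A countable covering makes the space itself Polish. The empty space is treated apart, since it
may be covered by the empty family. -/
theorem IsPolishCovering.polishPart_le_of_mk_le_aleph0 [IsCompletelyMetrizableSpace X]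
    {C : Set (Set X)} (hC : IsPolishCovering X C) (hcard : #C ≤ ℵ₀) : polishPart X ≤ #C := by
  rcases isEmpty_or_nonempty X with hX | ⟨⟨x⟩⟩
  · exact polishPart_le_mk.trans (by simp)
  have hsep : IsSeparable (univ : Set X) := by
    rw [← hC.2]
    have := (le_aleph0_iff_set_countable.1 hcard).to_subtype
    rw [sUnion_eq_iUnion]
    refine .iUnion fun s => ?_
    have := hC.1 s s.2
    exact .of_subtype _
  have h1 : HasPolishDecomposition 1 (univ : Set X) :=
    ⟨{univ}, (mk_singleton _).le, by rintro _ rfl; exact IsGδ.univ.polishSpace hsep,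
      pairwiseDisjoint_singleton _ _, sUnion_singleton _⟩
  refine h1.polishPart_le.trans ?_
  obtain ⟨s, hs, -⟩ := mem_sUnion.1 (hC.2 ▸ mem_univ x : x ∈ ⋃₀ C)
  have : Nonempty C := ⟨⟨s, hs⟩⟩
  rw [Cardinal.one_le_iff_ne_zero]
  exact mk_ne_zero C

theorem IsPolishCovering.polishPart_le_of_mk_le_aleph_omega0 [IsCompletelyMetrizableSpace X]
    {C : Set (Set X)} (hC : IsPolishCovering X C) (hcard : #C ≤ ℵ_ Ordinal.omega0) :
    polishPart X ≤ #C := by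
  rcases le_or_gt #C ℵ₀ with h0 | h0
  · exact hC.polishPart_le_of_mk_le_aleph0 h0
  obtain ⟨o, ho⟩ := mem_range_aleph_iff.2 h0.le
  rcases hcard.eq_or_lt with heq | hlt
  · exact heq ▸ (HasPolishDecomposition.of_isPolishCovering_aleph_omega0 hC hcard).polishPart_le
  · rw [← ho] at hlt
    obtain ⟨n, rfl⟩ := Ordinal.lt_omega0.1 (aleph_lt_aleph.1 hlt)
    rw [← ho]
    refine (HasPolishDecomposition.of_densityLE_aleph_nat n .univ ?_).polishPart_le
    refine (DensityLE.closure_iUnion (s := fun s : C => (s : Set X)) (aleph0_le_aleph n) ho.ge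
      fun s => ?_).mono le_rfl ?_
    · have := hC.1 s s.2
      exact .of_subtype _
    · rw [← sUnion_eq_iUnion, hC.2]
      exact subset_closure

/-! ### The size of the continuum -/

theorem mainTheorem9
    (h : ∃ (X : Type u) (_ : TopologicalSpace X),
      TopologicalSpace.IsCompletelyMetrizableSpace X ∧ polishCov X < polishPart X) :
    ℵ_ (ω + 2) ≤ (𝔠 : Cardinal.{u}) := by
  obtain ⟨X, _, _, hlt⟩ := h
  obtain ⟨C, hC, hcard⟩ := exists_isPolishCovering_card_eq X
  rw [← hcard] at hlt
  have h1 : ℵ_ (ω + 1) ≤ #C := by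
    rw [← succ_aleph, Order.succ_le_iff]
    exact lt_of_not_ge fun h => hlt.not_ge (hC.polishPart_le_of_mk_le_aleph_omega0 h)
  have h2 : #C < 𝔠 := by
    refine lt_of_not_ge fun h => hlt.not_ge ?_
    exact polishPart_le_mk.trans (hC.mk_le.trans (mul_eq_left (aleph0_le_continuum.trans h) h
      continuum_ne_zero).le)
  rw [← one_add_one_eq_two, ← add_assoc, ← succ_aleph, Order.succ_le_iff]
  exact h1.trans_lt h2
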